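/- **Setting.** Let $\mathcal S,\mathcal A$ be finite sets of states and actions, $S=|\mathcal S|$, $A=|\mathcal A|$. A (deterministic) model $M$ answers each query $(s,a)\in\mathcal S\times\mathcal A$ with a next state and an optional error message; a transition $(s,a,s')$ is *feasible* in $M$ if the answer to $(s,a)$ is $s'$ without error. Its reward is $R^M(s,a,s')=0$ if it is feasible in $M$ and $-1$ otherwise. Fix an initial state $s_0$, a goal state $s_g$ and a finite non-empty set $\mathcal P$ of paths from $s_0$ to $s_g$ (finite sequences of chained transitions); let $\tau$ be the length of the longest path in $\mathcal P$. The value of a path $\xi$ in $M$ is $V^M_\xi=\sum_{(s,a,s')\in\xi}R^M(s,a,s')$, i.e. minus its number of infeasible transitions. A path of $\mathcal P$ is optimal in $M$ if it maximizes $V^M_\xi$ over $\xi\in\mathcal P$, and feasible in $M$ if all its transitions are. **Boomerang as posterior sampling.** The true model $M^\star$ is drawn from a (discrete) prior. In iteration $t=0,1,2,\dots$, given the history $H_t$ of all query/response pairs so far, a model $M_t$ is sampled from the posterior distribution of $M^\star$ given $H_t$, independently of $M^\star$ given $H_t$; a path $\xi_t\in\mathcal P$ that is optimal in $M_t$ is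 chosen (by any rule, possibly randomized, that depends only on $M_t$ and $H_t$); and every transition of $\xi_t$ is queried in $M^\star$, the query/response pairs being appended to the history. The game terminates as soon as $\xi_t$ is feasible in $M^\star$. The regret of iteration $t$ is $\Delta_t=V^{M^\star}_{\xi^\star}-V^{M^\star}_{\xi_t}$, where $\xi^\star$ is an optimal path in $M^\star$ (and $\Delta_t=0$ after termination), and $\mathrm{BayesRegret}(T)=\mathbb E\sum_{t=0}^{T}\Delta_t$. **Theorem.** There is a universal constant $C>0$ such that, in every such setting and for every $T$ with $SAT\ge 2$, $$\mathrm{BayesRegret}(T)\le C\,\tau\sqrt{S\,A\,T\,\log(S\,A\,T)} .$$ Moreover, if with probability one the true model admits a feasible path in $\mathcal P$, then $\mathrm{BayesRegret}(T)$ equals the expected number of infeasible transitions (counted with multiplicity) queried during the iterations $0,\dots,T$ until a feasible path is found. -/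

import Mathlib

namespace Boomerang

/-- A deterministic world model: the query `(s, a)` is answered by the next state together with an
optional error message (from a type `E` of messages), present exactly when the action is invalid. -/
abbrev Model (S A E : Type*) := S → A → S × Option E

/-- A transition `(s, a, s')`. -/
abbrev Transition (S A : Type*) := S × A × S

/-- A path, as the list of its transitions. -/
abbrev Path (S A : Type*) := List (Transition S A)

/-- A history of query/response pairs. -/
abbrev History (S A E : Type*) := List ((S × A) × (S × Option E))

/-- `ξ` is a chain of transitions leading from the first state to the second. -/
def IsPathFromTo {S A : Type*} : S → S → Path S A → Prop
  | s, g, [] => s = g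
  | s, g, e :: ξ => e.1 = s ∧ IsPathFromTo e.2.2 g ξ

/-- `(s, a, s')` is feasible in `M`: the action is valid at `s` and leads to `s'`. -/
def Feasible {S A E : Type*} (M : Model S A E) (e : Transition S A) : Prop :=
  M e.1 e.2.1 = (e.2.2, none)

/-- All transitions of the path are feasible in `M`. -/
def FeasiblePath {S A E : Type*} (M : Model S A E) (ξ : Path S A) : Prop :=
  ∀ e ∈ ξ, Feasible M e

open Classical in
/-- The reward of a transition: `0` if it is feasible in `M`, and `-1` if it is not. -/
noncomputable def reward {S A E : Type*} (M : Model S A E) (e : Transition S A) : ℝ :=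
  if Feasible M e then 0 else -1

/-- The cumulative reward of the path `ξ` in the model `M`. -/
noncomputable def value {S A E : Type*} (M : Model S A E) (ξ : Path S A) : ℝ :=
  (ξ.map (reward M)).sum

/-- `ξ` is an optimal path in the model `M`, among the paths in `P`. -/
def IsOptimalPath {S A E : Type*} (P : Finset (Path S A)) (M : Model S A E) (ξ : Path S A) :
    Prop :=
  ξ ∈ P ∧ ∀ ζ ∈ P, value M ζ ≤ value M ξ

/-- The value in `M` of an optimal path. -/
noncomputable def optimalValue {S A E : Type*} (P : Finset (Path S A)) (hP : P.Nonempty)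
    (M : Model S A E) : ℝ :=
  P.sup' hP (value M)

/-- The model `M` gives all the responses recorded in `H`. -/
def Consistent {S A E : Type*} (M : Model S A E) (H : History S A E) : Prop :=
  ∀ x ∈ H, M x.1.1 x.1.2 = x.2

open Classical in
/-- The Bayesian posterior given the history `H`. Responses are deterministic, so the likelihood of
`H` under `M` is `1` if `M` is consistent with `H` and `0` otherwise, and Bayes' rule gives the
prior restricted to the consistent models and renormalized. (For a history of prior probability
zero, which never occurs in a run, the value is irrelevant.) -/
noncomputable def posterior {S A E : Type*} (prior : PMF (Model S A E)) (H : History S A E) :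
    PMF (Model S A E) :=
  if h : ∃ M ∈ {M : Model S A E | Consistent M H}, M ∈ prior.support then
    prior.filter {M : Model S A E | Consistent M H} h
  else prior

/-- The history produced when all transitions of the paths `ξs` are queried, in order, in `M`. -/
def historyOf {S A E : Type*} (M : Model S A E) (ξs : List (Path S A)) : History S A E :=
  ξs.flatMap fun ξ => ξ.map fun e => ((e.1, e.2.1), M e.1 e.2.1)

open Classical in
/-- The law of the list of paths proposed and queried in the first `n` iterations, when the true
model is `Mstar`. In each iteration a model is sampled from the posterior given the history, a plan
for it is drawn by the planner `plan`, and all transitions of this plan are queried. The game is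
over once a path feasible in `Mstar` has been found: no more paths are added then. -/
noncomputable def runLaw {S A E : Type*} (prior : PMF (Model S A E))
    (plan : History S A E → Model S A E → PMF (Path S A)) (Mstar : Model S A E) :
    ℕ → PMF (List (Path S A))
  | 0 => PMF.pure []
  | n + 1 => (runLaw prior plan Mstar n).bind fun ξs =>
      if ∃ ξ ∈ ξs, FeasiblePath Mstar ξ then PMF.pure ξs
      else (posterior prior (historyOf Mstar ξs)).bind fun M =>
        (plan (historyOf Mstar ξs) M).map fun ξ => ξs ++ [ξ]

/-- The joint law of the true model, drawn from the prior, and of the paths queried in the first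
`n` iterations. -/
noncomputable def jointLaw {S A E : Type*} (prior : PMF (Model S A E))
    (plan : History S A E → Model S A E → PMF (Path S A)) (n : ℕ) :
    PMF (Model S A E × List (Path S A)) :=
  prior.bind fun Mstar => (runLaw prior plan Mstar n).map fun ξs => (Mstar, ξs)

/-- Expectation of `f` under the discrete law `p`. (Only used for functions that are bounded on the
support of `p`, for which the series converges absolutely.) -/
noncomputable def expectation {Ω : Type*} (p : PMF Ω) (f : Ω → ℝ) : ℝ :=
  ∑' ω, (p ω).toReal * f ω

/-- The Bayesian regret: the expectation of the sum, over the iterations `t = 0, …, T`, of the value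
of an optimal path in the true model minus the value there of the path `ξ_t`. -/
noncomputable def bayesRegret {S A E : Type*} (P : Finset (Path S A)) (hP : P.Nonempty)
    (prior : PMF (Model S A E)) (plan : History S A E → Model S A E → PMF (Path S A)) (T : ℕ) :
    ℝ :=
  expectation (jointLaw prior plan (T + 1)) fun ω =>
    (ω.2.map fun ξ => optimalValue P hP ω.1 - value ω.1 ξ).sum

open Classical in
/-- The expected number of infeasible transitions queried in the iterations `t = 0, …, T` until a
feasible path is found. -/
noncomputable def expectedInfeasibleQueries {S A E : Type*} (prior : PMF (Model S A E))
    (plan : History S A E → Model S A E → PMF (Path S A)) (T : ℕ) : ℝ :=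
  expectation (jointLaw prior plan (T + 1)) fun ω =>
    (((ω.2.map fun ξ => ξ.countP fun e => decide (¬ Feasible ω.1 e)).sum : ℕ) : ℝ)

end Boomerang

/-! The regret is the total number of infeasible transitions minus (iterations played) times the
least loss `minLoss` in the true model. Given the history, the sampled model and the true model have
the same law (`mean_posterior_eq`), and the decision to stop depends on the history alone, so in
expectation the least loss of the true model may be replaced by that of the sampled one
(`mean_meanIncrement_sampled`). This is the loss of the chosen path in the sampled model. Both
models agree on all pairs already queried, so the path loses more in the true model only if it
queries a new pair, and then at most `τ` more (`loss_le_loss_add`). There are at most `S * A` new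
pairs in all, so the regret is at most `τ * S * A`. It is also at most `τ * (T + 1)`, and the
minimum of the two is below their geometric mean. -/

namespace Boomerang

open scoped ENNReal

/-- Expectation of an extended nonnegative function under a discrete law. -/
noncomputable def mean {Ω : Type*} (p : PMF Ω) (f : Ω → ℝ≥0∞) : ℝ≥0∞ :=
  ∑' x, p x * f x

/-! ### Means under discrete laws -/

section Mean

variable {Ω Ω' : Type*}

lemma mean_pure (x : Ω) (f : Ω → ℝ≥0∞) : mean (PMF.pure x) f = f x := by
  classical
  rw [mean, tsum_eq_single x]
  · simp
  · intro y hy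
    simp [PMF.pure_apply, hy]

lemma mean_bind (p : PMF Ω) (q : Ω → PMF Ω') (f : Ω' → ℝ≥0∞) :
    mean (p.bind q) f = mean p fun x => mean (q x) f := by
  simp only [mean, PMF.bind_apply, ← ENNReal.tsum_mul_right, ← ENNReal.tsum_mul_left]
  rw [ENNReal.tsum_comm]
  simp only [mul_assoc]

lemma mean_map (p : PMF Ω) (g : Ω → Ω') (f : Ω' → ℝ≥0∞) :
    mean (p.map g) f = mean p fun x => f (g x) := by
  rw [PMF.map, mean_bind]
  simp only [Function.comp_apply, mean_pure]

lemma mean_add (p : PMF Ω) (f g : Ω → ℝ≥0∞) :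
    mean p (fun x => f x + g x) = mean p f + mean p g := by
  simp only [mean, mul_add, ENNReal.tsum_add]

lemma mean_const (p : PMF Ω) (c : ℝ≥0∞) : mean p (fun _ => c) = c := by
  simp [mean, ENNReal.tsum_mul_right, p.tsum_coe]

lemma mean_mono_of_support (p : PMF Ω) {f g : Ω → ℝ≥0∞} (h : ∀ x ∈ p.support, f x ≤ g x) :
    mean p f ≤ mean p g := by
  refine ENNReal.tsum_le_tsum fun x => ?_
  by_cases hx : p x = 0
  · simp [hx]
  · exact mul_le_mul_right (h x ((p.mem_support_iff x).2 hx)) _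

/-- Finite means make both real series summable. All estimates can thus be made in `ℝ≥0∞`, where
sums commute freely, with one return to `ℝ` at the end. -/
lemma expectation_sub (p : PMF Ω) (f g : Ω → ℕ) (hf : mean p (fun x => f x) ≠ ∞)
    (hg : mean p (fun x => g x) ≠ ∞) :
    expectation p (fun x => (f x : ℝ) - g x) =
      (mean p fun x => f x).toReal - (mean p fun x => g x).toReal := by
  have key : ∀ u : Ω → ℕ, ∀ x, (p x * (u x : ℝ≥0∞)).toReal = (p x).toReal * u x := by
    intro u x
    simp [ENNReal.toReal_mul]
  have hne : ∀ u : Ω → ℕ, ∀ x, p x * (u x : ℝ≥0∞) ≠ ∞ := fun u x =>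
    ENNReal.mul_ne_top (p.apply_ne_top x) (ENNReal.natCast_ne_top _)
  have sf := ENNReal.summable_toReal hf
  have sg := ENNReal.summable_toReal hg
  simp only [key] at sf sg
  rw [mean, mean, ENNReal.tsum_toReal_eq (hne f), ENNReal.tsum_toReal_eq (hne g)]
  simp only [key, expectation, mul_sub]
  exact sf.tsum_sub sg

end Mean

/-! ### Losses and regret -/

section Setting

variable {S A E : Type*}

open Classical in
/-- The number of infeasible transitions of a path. -/
noncomputable def loss (M : Model S A E) (ξ : Path S A) : ℕ :=
  ξ.countP fun e => decide (¬ Feasible M e)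

/-- The least number of infeasible transitions of a path in `P`. -/
noncomputable def minLoss (P : Finset (Path S A)) (hP : P.Nonempty) (M : Model S A E) : ℕ :=
  P.inf' hP (loss M)

lemma value_eq_neg_loss (M : Model S A E) (ξ : Path S A) : value M ξ = -(loss M ξ : ℝ) := by
  induction ξ with
  | nil => simp [value, loss]
  | cons e ξ ih =>
    simp only [value, loss, List.map_cons, List.sum_cons, List.countP_cons] at ih ⊢
    rw [ih]
    by_cases h : Feasible M e <;> simp [reward, h, add_comm]

lemma loss_le_length (M : Model S A E) (ξ : Path S A) : loss M ξ ≤ ξ.length :=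
  List.countP_le_length

lemma loss_eq_zero {M : Model S A E} {ξ : Path S A} (h : FeasiblePath M ξ) : loss M ξ = 0 := by
  exact List.countP_eq_zero.2 fun e he => by simpa using h e he

lemma IsOptimalPath.loss_eq {P : Finset (Path S A)} (hP : P.Nonempty) {M : Model S A E}
    {ξ : Path S A} (h : IsOptimalPath P M ξ) : loss M ξ = minLoss P hP M := by
  refine le_antisymm (Finset.le_inf' _ _ fun ζ hζ => ?_) (Finset.inf'_le _ h.1)
  have := h.2 ζ hζ
  rw [value_eq_neg_loss, value_eq_neg_loss, neg_le_neg_iff] at this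
  exact_mod_cast this

lemma optimalValue_eq_neg_minLoss (P : Finset (Path S A)) (hP : P.Nonempty) (M : Model S A E) :
    optimalValue P hP M = -(minLoss P hP M : ℝ) := by
  obtain ⟨ξ, hξ, h⟩ := Finset.exists_mem_eq_inf' hP (loss M)
  refine le_antisymm (Finset.sup'_le _ _ fun ζ hζ => ?_) ?_
  · rw [value_eq_neg_loss, neg_le_neg_iff]
    exact_mod_cast Finset.inf'_le _ hζ
  · rw [minLoss, h, ← value_eq_neg_loss]
    exact Finset.le_sup' _ hξ

/-- The total number of infeasible transitions along a list of paths. -/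
noncomputable def totalLoss (M : Model S A E) (ξs : List (Path S A)) : ℕ :=
  (ξs.map (loss M)).sum

lemma totalLoss_append (M : Model S A E) (ξs : List (Path S A)) (ξ : Path S A) :
    totalLoss M (ξs ++ [ξ]) = totalLoss M ξs + loss M ξ := by
  simp [totalLoss]

lemma sum_regret_eq (P : Finset (Path S A)) (hP : P.Nonempty) (M : Model S A E)
    (ξs : List (Path S A)) :
    (ξs.map fun ξ => optimalValue P hP M - value M ξ).sum =
      (totalLoss M ξs : ℝ) - ((ξs.length * minLoss P hP M : ℕ) : ℝ) := by
  induction ξs with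
  | nil => simp [totalLoss]
  | cons ξ ξs ih =>
    rw [List.map_cons, List.sum_cons, ih, optimalValue_eq_neg_minLoss, value_eq_neg_loss]
    simp only [totalLoss, List.map_cons, List.sum_cons, List.length_cons]
    push_cast
    ring

/-! ### Histories and the posterior -/

lemma consistent_historyOf_iff {M M' : Model S A E} {ξs : List (Path S A)} :
    Consistent M' (historyOf M ξs) ↔ ∀ ξ ∈ ξs, ∀ e ∈ ξ, M' e.1 e.2.1 = M e.1 e.2.1 := by
  constructor
  · intro h ξ hξ e he
    exact h ((e.1, e.2.1), M e.1 e.2.1)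
      (List.mem_flatMap.2 ⟨ξ, hξ, List.mem_map.2 ⟨e, he, rfl⟩⟩)
  · intro h x hx
    obtain ⟨ξ, hξ, hx⟩ := List.mem_flatMap.1 hx
    obtain ⟨e, he, rfl⟩ := List.mem_map.1 hx
    exact h ξ hξ e he

lemma historyOf_eq {M M' : Model S A E} {ξs : List (Path S A)}
    (h : Consistent M' (historyOf M ξs)) : historyOf M' ξs = historyOf M ξs := by
  rw [consistent_historyOf_iff] at h
  refine List.flatMap_congr fun ξ hξ => List.map_congr_left fun e he => ?_
  rw [h ξ hξ e he]

lemma consistent_historyOf_self (M : Model S A E) (ξs : List (Path S A)) :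
    Consistent M (historyOf M ξs) :=
  consistent_historyOf_iff.2 fun _ _ _ _ => rfl

lemma consistent_historyOf_comm {M M' : Model S A E} {ξs : List (Path S A)} :
    Consistent M' (historyOf M ξs) ↔ Consistent M (historyOf M' ξs) := by
  simp only [consistent_historyOf_iff, eq_comm]

lemma exists_feasiblePath_congr {M M' : Model S A E} {ξs : List (Path S A)}
    (h : Consistent M' (historyOf M ξs)) :
    (∃ ξ ∈ ξs, FeasiblePath M' ξ) ↔ ∃ ξ ∈ ξs, FeasiblePath M ξ := by
  rw [consistent_historyOf_iff] at h
  refine exists_congr fun ξ => and_congr_right fun hξ => forall₂_congr fun e he => ?_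
  rw [Feasible, Feasible, h ξ hξ e he]

open Classical in
lemma posterior_apply (prior : PMF (Model S A E)) {M : Model S A E} (hM : M ∈ prior.support)
    (ξs : List (Path S A)) (M' : Model S A E) :
    posterior prior (historyOf M ξs) M' =
      (if Consistent M' (historyOf M ξs) then prior M' else 0) *
        (∑' N, if Consistent N (historyOf M ξs) then prior N else 0)⁻¹ := by
  have h : ∃ N ∈ {N : Model S A E | Consistent N (historyOf M ξs)}, N ∈ prior.support :=
    ⟨M, consistent_historyOf_self M ξs, hM⟩
  rw [posterior, dif_pos h, PMF.filter_apply]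
  simp only [Set.indicator_apply, Set.mem_ofPred_eq]

lemma consistent_of_mem_support_posterior (prior : PMF (Model S A E)) {M M' : Model S A E}
    (hM : M ∈ prior.support) {ξs : List (Path S A)}
    (h : M' ∈ (posterior prior (historyOf M ξs)).support) : Consistent M' (historyOf M ξs) := by
  by_contra hc
  rw [PMF.mem_support_iff, posterior_apply prior hM, if_neg hc, zero_mul] at h
  exact h rfl

/-- Given the history, the sampled model has the same law as the true one: the weight `w` of the
true model may depend on it only through its responses along `ξs`. -/
lemma mean_posterior_eq (prior : PMF (Model S A E)) (ξs : List (Path S A))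
    (w h : Model S A E → ℝ≥0∞)
    (hw : ∀ M M', Consistent M' (historyOf M ξs) → w M' = w M) :
    (mean prior fun M => w M * mean (posterior prior (historyOf M ξs)) h) =
      mean prior fun M => w M * h M := by
  classical
  set Z : Model S A E → ℝ≥0∞ :=
    fun M => ∑' N, if Consistent N (historyOf M ξs) then prior N else 0 with hZ
  -- Consistency along `ξs` is symmetric, and `w` and `Z` are constant on consistent models, so
  -- these factors can be moved from `M` to `M'`. After exchanging the sums, the inner sum over `M`
  -- is `Z M'` and cancels the normalization.
  have hleft : ∀ M, prior M * (w M * mean (posterior prior (historyOf M ξs)) h) =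
      ∑' M', prior M' * h M' * (w M' * (Z M')⁻¹ *
        if Consistent M (historyOf M' ξs) then prior M else 0) := by
    intro M
    by_cases hM : prior M = 0
    · simp [hM]
    · simp only [mean, ← ENNReal.tsum_mul_left]
      refine tsum_congr fun M' => ?_
      rw [posterior_apply prior ((prior.mem_support_iff M).2 hM)]
      by_cases hc : Consistent M' (historyOf M ξs)
      · have hZe : Z M' = Z M := by simp only [hZ, historyOf_eq hc]
        rw [if_pos hc, if_pos (consistent_historyOf_comm.1 hc), hZe, hw M M' hc]
        ring
      · rw [if_neg hc, if_neg (fun h' => hc (consistent_historyOf_comm.1 h'))]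
        simp
  rw [mean, mean, tsum_congr hleft, ENNReal.tsum_comm]
  refine tsum_congr fun M' => ?_
  rw [ENNReal.tsum_mul_left, ENNReal.tsum_mul_left]
  by_cases hM' : prior M' = 0
  · simp [hM']
  have h0 : Z M' ≠ 0 := fun h0 => hM' <| by
    simpa [consistent_historyOf_self] using (ENNReal.tsum_eq_zero.1 h0) M'
  have htop : Z M' ≠ ∞ := by
    refine ne_top_of_le_ne_top ENNReal.one_ne_top ?_
    rw [← prior.tsum_coe]
    exact ENNReal.tsum_le_tsum fun N => by split_ifs <;> simp
  change prior M' * h M' * (w M' * (Z M')⁻¹ * Z M') = _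
  rw [mul_assoc (w M'), ENNReal.inv_mul_cancel h0 htop]
  ring

/-! ### The law of a run -/

variable (prior : PMF (Model S A E)) (plan : History S A E → Model S A E → PMF (Path S A))

/-- Sampling, planning and stopping see the true model only through its responses to past queries.
-/
lemma runLaw_congr (n : ℕ) {M M' : Model S A E} {ξs : List (Path S A)}
    (h : Consistent M' (historyOf M ξs)) :
    runLaw prior plan M' n ξs = runLaw prior plan M n ξs := by
  classical
  induction n generalizing ξs with
  | zero => rfl
  | succ n ih =>
    simp only [runLaw, PMF.bind_apply]
    refine tsum_congr fun ζs => ?_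
    -- A run only grows at its end, so only prefixes of `ξs` contribute, and agreement along `ξs`
    -- passes to them.
    by_cases hpre : ζs <+: ξs
    · have hζ : Consistent M' (historyOf M ζs) := by
        rw [consistent_historyOf_iff] at h ⊢
        exact fun ξ hξ => h ξ (hpre.subset hξ)
      rw [ih hζ, historyOf_eq hζ]
      simp only [exists_feasiblePath_congr hζ]
    · have hz : ∀ N : Model S A E, (if ∃ ξ ∈ ζs, FeasiblePath N ξ then PMF.pure ζs
          else (posterior prior (historyOf N ζs)).bind fun M =>
            (plan (historyOf N ζs) M).map fun ξ => ζs ++ [ξ]) ξs = 0 := by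
        intro N
        rw [PMF.apply_eq_zero_iff]
        split_ifs
        · rw [PMF.mem_support_pure_iff]
          rintro rfl
          exact hpre List.prefix_rfl
        · rw [PMF.mem_support_bind_iff]
          rintro ⟨N', -, hN'⟩
          obtain ⟨ξ, -, rfl⟩ := (PMF.mem_support_map_iff _ _ _).1 hN'
          exact hpre (List.prefix_append _ _)
      rw [hz, hz, mul_zero, mul_zero]

lemma mem_of_mem_support_runLaw {P : Finset (Path S A)}
    (hplan : ∀ H M, ∀ ξ ∈ (plan H M).support, IsOptimalPath P M ξ) (M : Model S A E) (n : ℕ)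
    {ξs : List (Path S A)} (h : ξs ∈ (runLaw prior plan M n).support) :
    ξs.length ≤ n ∧ ∀ ξ ∈ ξs, ξ ∈ P := by
  classical
  induction n generalizing ξs with
  | zero =>
    rw [runLaw, PMF.mem_support_pure_iff] at h
    simp [h]
  | succ n ih =>
    rw [runLaw, PMF.mem_support_bind_iff] at h
    obtain ⟨ζs, hζs, h⟩ := h
    obtain ⟨h1, h2⟩ := ih hζs
    split_ifs at h
    · rw [PMF.mem_support_pure_iff] at h
      subst h
      exact ⟨by omega, h2⟩
    · obtain ⟨N, -, hN⟩ := (PMF.mem_support_bind_iff _ _ _).1 h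
      obtain ⟨ξ, hξ, rfl⟩ := (PMF.mem_support_map_iff _ _ _).1 hN
      refine ⟨by simpa using h1, fun ζ hζ => ?_⟩
      rcases List.mem_append.1 hζ with hζ | hζ
      · exact h2 ζ hζ
      · rw [List.mem_singleton.1 hζ]
        exact (hplan _ _ ξ hξ).1

lemma mem_support_of_mem_support_jointLaw {n : ℕ} {ω : Model S A E × List (Path S A)}
    (h : ω ∈ (jointLaw prior plan n).support) :
    ω.1 ∈ prior.support ∧ ω.2 ∈ (runLaw prior plan ω.1 n).support := by
  obtain ⟨M, hM, h⟩ := (PMF.mem_support_bind_iff _ _ _).1 h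
  obtain ⟨ξs, hξs, rfl⟩ := (PMF.mem_support_map_iff _ _ _).1 h
  exact ⟨hM, hξs⟩

lemma mean_jointLaw (n : ℕ) (f : Model S A E × List (Path S A) → ℝ≥0∞) :
    mean (jointLaw prior plan n) f =
      mean prior fun M => mean (runLaw prior plan M n) fun ξs => f (M, ξs) := by
  rw [jointLaw, mean_bind]
  simp only [mean_map]

lemma mean_jointLaw_eq_tsum (n : ℕ) (f : Model S A E × List (Path S A) → ℝ≥0∞) :
    mean (jointLaw prior plan n) f =
      ∑' ξs, mean prior fun M => runLaw prior plan M n ξs * f (M, ξs) := by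
  rw [mean_jointLaw]
  simp only [mean, ← ENNReal.tsum_mul_left]
  exact ENNReal.tsum_comm

open Classical in
/-- The expected increment, in one more iteration, of a quantity which grows by `δ M M' ξs ξ` when
the path `ξ`, planned for the sampled model `M'`, is queried after `ξs` in the true model `M`. -/
noncomputable def meanIncrement
    (δ : Model S A E → Model S A E → List (Path S A) → Path S A → ℝ≥0∞)
    (ω : Model S A E × List (Path S A)) : ℝ≥0∞ :=
  if ∃ ξ ∈ ω.2, FeasiblePath ω.1 ξ then 0
  else mean (posterior prior (historyOf ω.1 ω.2)) fun M' =>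
    mean (plan (historyOf ω.1 ω.2) M') fun ξ => δ ω.1 M' ω.2 ξ

lemma mean_jointLaw_succ (n : ℕ) (f : Model S A E × List (Path S A) → ℝ≥0∞)
    (δ : Model S A E → List (Path S A) → Path S A → ℝ≥0∞)
    (hδ : ∀ M ξs ξ, f (M, ξs ++ [ξ]) = f (M, ξs) + δ M ξs ξ) :
    mean (jointLaw prior plan (n + 1)) f = mean (jointLaw prior plan n) f +
      mean (jointLaw prior plan n) (meanIncrement prior plan fun M _ => δ M) := by
  rw [← mean_add, mean_jointLaw, mean_jointLaw]
  congr 1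
  funext M
  rw [runLaw, mean_bind]
  congr 1
  funext ξs
  rw [meanIncrement]
  split_ifs with h
  · rw [mean_pure, add_zero]
  · simp only [mean_bind, mean_map, hδ, mean_add, mean_const]

lemma meanIncrement_add (δ ε : Model S A E → Model S A E → List (Path S A) → Path S A → ℝ≥0∞) :
    meanIncrement prior plan (fun M M' ξs ξ => δ M M' ξs ξ + ε M M' ξs ξ) =
      fun ω => meanIncrement prior plan δ ω + meanIncrement prior plan ε ω := by
  funext ω
  simp only [meanIncrement]
  split_ifs
  · simp
  · simp only [mean_add]

/-- For each fixed `ξs`, the weight (probability of the run, times the indicator that it has not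
stopped) depends on the true model only through its responses along `ξs`, as `mean_posterior_eq`
requires. -/
lemma mean_meanIncrement_sampled (n : ℕ) (h : Model S A E → ℝ≥0∞) :
    mean (jointLaw prior plan n) (meanIncrement prior plan fun _ M' _ _ => h M') =
      mean (jointLaw prior plan n) (meanIncrement prior plan fun M _ _ _ => h M) := by
  classical
  rw [mean_jointLaw_eq_tsum, mean_jointLaw_eq_tsum]
  refine tsum_congr fun ξs => ?_
  have key := mean_posterior_eq prior ξs (fun M => runLaw prior plan M n ξs *
    if ∃ ξ ∈ ξs, FeasiblePath M ξ then 0 else 1) h (fun M M' hc => by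
      simp only [runLaw_congr prior plan n hc, exists_feasiblePath_congr hc])
  simp only [meanIncrement, mean_const]
  convert key using 2
  · funext M
    split_ifs <;> simp
  · funext M
    split_ifs <;> simp

/-! ### Counting newly queried pairs -/

open Classical in
/-- The state-action pairs queried along a list of paths. -/
noncomputable def queried (ξs : List (Path S A)) : Finset (S × A) :=
  (ξs.flatMap fun ξ => ξ.map fun e => (e.1, e.2.1)).toFinset

lemma mem_queried {ξs : List (Path S A)} {x : S × A} :
    x ∈ queried ξs ↔ ∃ ξ ∈ ξs, ∃ e ∈ ξ, (e.1, e.2.1) = x := by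
  simp only [queried, List.mem_toFinset, List.mem_flatMap, List.mem_map]

lemma queried_subset_append (ξs ζs : List (Path S A)) : queried ξs ⊆ queried (ξs ++ ζs) := by
  intro x hx
  obtain ⟨ξ, hξ, h⟩ := mem_queried.1 hx
  exact mem_queried.2 ⟨ξ, List.mem_append_left _ hξ, h⟩

/-- Two models with the same responses along `ξs` give different losses to `ξ` only if `ξ` queries
a new state-action pair. -/
lemma loss_le_loss_add {M M' : Model S A E} {ξs : List (Path S A)}
    (h : Consistent M' (historyOf M ξs)) {ξ : Path S A} {τ : ℕ} (hτ : ξ.length ≤ τ) :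
    loss M ξ ≤ loss M' ξ + τ * ((queried (ξs ++ [ξ])).card - (queried ξs).card) := by
  classical
  rw [consistent_historyOf_iff] at h
  by_cases hnew : queried (ξs ++ [ξ]) ⊆ queried ξs
  · refine le_add_right (le_of_eq ?_)
    refine List.countP_congr fun e he => ?_
    obtain ⟨ζ, hζ, e', he', heq⟩ := mem_queried.1 (hnew (mem_queried.2
      ⟨ξ, List.mem_append_right _ (List.mem_singleton_self ξ), e, he, rfl⟩))
    have := h ζ hζ e' he'
    obtain ⟨h1, h2⟩ := Prod.ext_iff.1 heq
    simp only at h1 h2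
    rw [h1, h2] at this
    have hiff : Feasible M e ↔ Feasible M' e := by rw [Feasible, Feasible, this]
    simp [hiff]
  · have hlt := Finset.card_lt_card (Finset.ssubset_iff_subset_ne.2
      ⟨queried_subset_append ξs [ξ], fun heq => hnew heq.ge⟩)
    calc loss M ξ ≤ τ * 1 := by simpa using (loss_le_length M ξ).trans hτ
      _ ≤ τ * ((queried (ξs ++ [ξ])).card - (queried ξs).card) :=
        Nat.mul_le_mul_left _ (by omega)
      _ ≤ _ := Nat.le_add_left _ _

/-- Induction on the iterations: the increments are compared pointwise with the sampled model's
least loss, which is then exchanged for the true one in the mean. The least loss stands on the right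
to avoid subtraction in `ℝ≥0∞`. -/
lemma mean_totalLoss_le {P : Finset (Path S A)} (hP : P.Nonempty)
    (hplan : ∀ H M, ∀ ξ ∈ (plan H M).support, IsOptimalPath P M ξ) {τ : ℕ}
    (hτ : ∀ ξ ∈ P, ξ.length ≤ τ) (n : ℕ) :
    mean (jointLaw prior plan n) (fun ω => totalLoss ω.1 ω.2) ≤
      mean (jointLaw prior plan n) fun ω =>
        ((ω.2.length * minLoss P hP ω.1 + τ * (queried ω.2).card : ℕ) : ℝ≥0∞) := by
  induction n with
  | zero =>
    rw [mean_jointLaw, mean_jointLaw]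
    simp [runLaw, mean_pure, totalLoss, mean_const]
  | succ n ih =>
    rw [mean_jointLaw_succ prior plan n (fun ω => (totalLoss ω.1 ω.2 : ℝ≥0∞))
        (fun M _ ξ => loss M ξ) (fun M ξs ξ => by rw [totalLoss_append]; push_cast; rfl),
      mean_jointLaw_succ prior plan n
        (fun ω => ((ω.2.length * minLoss P hP ω.1 + τ * (queried ω.2).card : ℕ) : ℝ≥0∞))
        (fun M ξs ξ => (minLoss P hP M : ℝ≥0∞) +
          ((τ * ((queried (ξs ++ [ξ])).card - (queried ξs).card) : ℕ) : ℝ≥0∞))]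
    · refine add_le_add ih ?_
      calc mean (jointLaw prior plan n) (meanIncrement prior plan fun M _ _ ξ => loss M ξ)
          ≤ mean (jointLaw prior plan n) (meanIncrement prior plan fun _ M' ξs ξ =>
              (minLoss P hP M' : ℝ≥0∞) +
                ((τ * ((queried (ξs ++ [ξ])).card - (queried ξs).card) : ℕ) : ℝ≥0∞)) := by
            refine mean_mono_of_support _ fun ω hω => ?_
            have hM := (mem_support_of_mem_support_jointLaw prior plan hω).1
            simp only [meanIncrement]
            split_ifs
            · exact le_rfl
            refine mean_mono_of_support _ fun M' hM' => mean_mono_of_support _ fun ξ hξ => ?_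
            have hopt := hplan _ _ ξ hξ
            rw [← hopt.loss_eq hP]
            exact_mod_cast loss_le_loss_add
              (consistent_of_mem_support_posterior prior hM hM') (hτ ξ hopt.1)
        _ = _ := by
            rw [meanIncrement_add, meanIncrement_add, mean_add, mean_add]
            rw [mean_meanIncrement_sampled prior plan n fun M => (minLoss P hP M : ℝ≥0∞)]
    -- The truncated subtraction is exact because the set of queried pairs only grows.
    · intro M ξs ξ
      have := Finset.card_le_card (queried_subset_append ξs [ξ])
      obtain ⟨d, hd⟩ := Nat.exists_eq_add_of_le this
      simp only [hd, List.length_append, List.length_singleton, Nat.add_sub_cancel_left]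
      push_cast
      ring

lemma totalLoss_le {P : Finset (Path S A)} {τ : ℕ} (hτ : ∀ ξ ∈ P, ξ.length ≤ τ)
    (M : Model S A E) {ξs : List (Path S A)} (h : ∀ ξ ∈ ξs, ξ ∈ P) :
    totalLoss M ξs ≤ ξs.length * τ := by
  have := List.sum_le_card_nsmul (ξs.map (loss M)) τ (by
    intro x hx
    obtain ⟨ξ, hξ, rfl⟩ := List.mem_map.1 hx
    exact (loss_le_length M ξ).trans (hτ ξ (h ξ hξ)))
  simpa [totalLoss] using this

lemma minLoss_le {P : Finset (Path S A)} (hP : P.Nonempty) {τ : ℕ}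
    (hτ : ∀ ξ ∈ P, ξ.length ≤ τ) (M : Model S A E) : minLoss P hP M ≤ τ := by
  obtain ⟨ξ, hξ⟩ := hP
  exact (Finset.inf'_le _ hξ).trans ((loss_le_length M ξ).trans (hτ ξ hξ))

/-! ### The regret bounds -/

lemma bayesRegret_le_min [Fintype S] [Fintype A] {P : Finset (Path S A)} (hP : P.Nonempty)
    (hplan : ∀ H M, ∀ ξ ∈ (plan H M).support, IsOptimalPath P M ξ) {τ : ℕ}
    (hτ : ∀ ξ ∈ P, ξ.length ≤ τ) (T : ℕ) :
    bayesRegret P hP prior plan T ≤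
      τ * min ((Fintype.card S : ℝ) * Fintype.card A) (T + 1) := by
  set J := jointLaw prior plan (T + 1) with hJ
  have hlen : ∀ ω ∈ J.support, ω.2.length ≤ T + 1 ∧ ∀ ξ ∈ ω.2, ξ ∈ P := fun ω hω =>
    mem_of_mem_support_runLaw prior plan hplan ω.1 (T + 1)
      (mem_support_of_mem_support_jointLaw prior plan hω).2
  have hA : mean J (fun ω => totalLoss ω.1 ω.2) ≤ (((T + 1) * τ : ℕ) : ℝ≥0∞) := by
    rw [← mean_const J (((T + 1) * τ : ℕ) : ℝ≥0∞)]
    refine mean_mono_of_support _ fun ω hω => Nat.cast_le.2 ?_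
    exact (totalLoss_le hτ ω.1 (hlen ω hω).2).trans (Nat.mul_le_mul_right _ (hlen ω hω).1)
  have hB : mean J (fun ω => ((ω.2.length * minLoss P hP ω.1 : ℕ) : ℝ≥0∞)) ≤
      (((T + 1) * τ : ℕ) : ℝ≥0∞) := by
    rw [← mean_const J (((T + 1) * τ : ℕ) : ℝ≥0∞)]
    refine mean_mono_of_support _ fun ω hω => Nat.cast_le.2 ?_
    exact Nat.mul_le_mul (hlen ω hω).1 (minLoss_le hP hτ ω.1)
  have hAB : mean J (fun ω => totalLoss ω.1 ω.2) ≤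
      mean J (fun ω => ((ω.2.length * minLoss P hP ω.1 : ℕ) : ℝ≥0∞)) +
        ((τ * (Fintype.card S * Fintype.card A) : ℕ) : ℝ≥0∞) := by
    refine (mean_totalLoss_le prior plan hP hplan hτ (T + 1)).trans ?_
    rw [← mean_const J ((τ * (Fintype.card S * Fintype.card A) : ℕ) : ℝ≥0∞), ← mean_add]
    refine mean_mono_of_support _ fun ω _ => ?_
    rw [← Nat.cast_add, Nat.cast_le]
    refine Nat.add_le_add_left (Nat.mul_le_mul_left _ ?_) _
    rw [← Fintype.card_prod]
    exact Finset.card_le_univ _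
  have hA' := ne_top_of_le_ne_top (ENNReal.natCast_ne_top _) hA
  have hB' := ne_top_of_le_ne_top (ENNReal.natCast_ne_top _) hB
  have hreg : bayesRegret P hP prior plan T =
      (mean J fun ω => totalLoss ω.1 ω.2).toReal -
        (mean J fun ω => ((ω.2.length * minLoss P hP ω.1 : ℕ) : ℝ≥0∞)).toReal := by
    rw [← expectation_sub J (fun ω => totalLoss ω.1 ω.2)
      (fun ω => ω.2.length * minLoss P hP ω.1) hA' hB']
    simp only [bayesRegret, sum_regret_eq, hJ]
  have h1 := ENNReal.toReal_mono (ENNReal.natCast_ne_top _) hA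
  have h2 := ENNReal.toReal_mono (ENNReal.add_ne_top.2 ⟨hB', ENNReal.natCast_ne_top _⟩) hAB
  rw [ENNReal.toReal_add hB' (ENNReal.natCast_ne_top _), ENNReal.toReal_natCast] at h2
  rw [ENNReal.toReal_natCast] at h1
  have h3 : 0 ≤ (mean J fun ω => ((ω.2.length * minLoss P hP ω.1 : ℕ) : ℝ≥0∞)).toReal :=
    ENNReal.toReal_nonneg
  push_cast at h1 h2 h3 hreg
  rw [hreg]
  rcases min_choice ((Fintype.card S : ℝ) * Fintype.card A) (T + 1) with h | h <;> rw [h]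
  · linarith
  · linarith

lemma bayesRegret_eq_expectedInfeasibleQueries {P : Finset (Path S A)} (hP : P.Nonempty)
    (h : ∀ M ∈ prior.support, ∃ ξ ∈ P, FeasiblePath M ξ) (T : ℕ) :
    bayesRegret P hP prior plan T = expectedInfeasibleQueries prior plan T := by
  simp only [bayesRegret, expectedInfeasibleQueries, expectation, sum_regret_eq]
  refine tsum_congr fun ω => ?_
  by_cases hω : jointLaw prior plan (T + 1) ω = 0
  · simp [hω]
  obtain ⟨ξ, hξ, hfeas⟩ := h ω.1
    (mem_support_of_mem_support_jointLaw prior plan ((PMF.mem_support_iff _ _).2 hω)).1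
  have h0 : minLoss P hP ω.1 = 0 :=
    Nat.le_zero.1 (loss_eq_zero hfeas ▸ Finset.inf'_le _ hξ)
  rw [h0, mul_zero, Nat.cast_zero, sub_zero]
  rfl

end Setting

/-- The square of the minimum is at most `m * (T + 1) ≤ 2 * m * T`. The logarithm is needed only
through its lower bound `log 2 ≥ 1 / 2`. -/
lemma min_le_two_mul_sqrt_mul_log {m T : ℕ} (h : 2 ≤ m * T) :
    min (m : ℝ) (T + 1) ≤ 2 * √((m : ℝ) * T * Real.log ((m : ℝ) * T)) := by
  have hT : (1 : ℝ) ≤ T := by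
    exact_mod_cast Nat.one_le_iff_ne_zero.2 (by rintro rfl; simp at h)
  have hm : (0 : ℝ) ≤ m := Nat.cast_nonneg m
  have h2 : (2 : ℝ) ≤ m * T := by exact_mod_cast h
  have hlog : 1 / 2 ≤ Real.log ((m : ℝ) * T) :=
    (by linarith [Real.log_two_gt_d9] : 1 / 2 ≤ Real.log 2).trans
      (Real.log_le_log (by norm_num) h2)
  have hmin : 0 ≤ min (m : ℝ) (T + 1) := le_min hm (by linarith)
  have hsq : (min (m : ℝ) (T + 1) / 2) ^ 2 ≤ (m : ℝ) * T * Real.log ((m : ℝ) * T) := by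
    have e1 : min (m : ℝ) (T + 1) * min (m : ℝ) (T + 1) ≤ m * (T + 1) :=
      mul_le_mul (min_le_left _ _) (min_le_right _ _) hmin hm
    have e2 : (m : ℝ) * 1 ≤ m * T := mul_le_mul_of_nonneg_left hT hm
    have e3 := mul_le_mul_of_nonneg_left hlog (by linarith : (0 : ℝ) ≤ m * T)
    linarith
  linarith [Real.le_sqrt_of_sq_le hsq]

end Boomerang

theorem mainTheorem1 :
    ∃ C : ℝ, 0 < C ∧
      ∀ (S A E : Type*) [Fintype S] [Fintype A] (s₀ sg : S)
        (P : Finset (Boomerang.Path S A)) (hP : P.Nonempty)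
        (_ : ∀ ξ ∈ P, Boomerang.IsPathFromTo s₀ sg ξ)
        (τ : ℕ) (_ : τ = P.sup List.length)
        (prior : PMF (Boomerang.Model S A E))
        (plan : Boomerang.History S A E → Boomerang.Model S A E → PMF (Boomerang.Path S A))
        (_ : ∀ H M, ∀ ξ ∈ (plan H M).support, Boomerang.IsOptimalPath P M ξ)
        (T : ℕ) (_ : 2 ≤ Fintype.card S * Fintype.card A * T),
        Boomerang.bayesRegret P hP prior plan T ≤
            C * (τ * √((Fintype.card S : ℝ) * Fintype.card A * T *
              Real.log ((Fintype.card S : ℝ) * Fintype.card A * T))) ∧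
          ((∀ M ∈ prior.support, ∃ ξ ∈ P, Boomerang.FeasiblePath M ξ) →
            Boomerang.bayesRegret P hP prior plan T =
              Boomerang.expectedInfeasibleQueries prior plan T) := by
  refine ⟨2, two_pos, ?_⟩
  intro S A E _ _ s₀ sg P hP _ τ hτ prior plan hplan T hT
  refine ⟨?_, fun h => Boomerang.bayesRegret_eq_expectedInfeasibleQueries prior plan hP h T⟩
  have hlen : ∀ ξ ∈ P, ξ.length ≤ τ := fun ξ hξ => hτ ▸ Finset.le_sup (f := List.length) hξ
  have hmin := Boomerang.min_le_two_mul_sqrt_mul_log hT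
  push_cast at hmin
  calc Boomerang.bayesRegret P hP prior plan T
      ≤ τ * min ((Fintype.card S : ℝ) * Fintype.card A) (T + 1) :=
        Boomerang.bayesRegret_le_min prior plan hP hplan hlen T
    _ ≤ τ * (2 * √((Fintype.card S : ℝ) * Fintype.card A * T *
          Real.log ((Fintype.card S : ℝ) * Fintype.card A * T))) :=
        mul_le_mul_of_nonneg_left hmin (Nat.cast_nonneg τ)
    _ = _ := by ring
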